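/- \textbf{Setting.} Let $\mathfrak L$ be the set of finite subsets of $\mathbb R^N$, directed by inclusion. Let $\mathbb K$ be an ordered field properly extending $\mathbb R$, with a $\Lambda$-limit $\varphi\mapsto\lim_{\lambda\uparrow\Lambda}\varphi(\lambda)\in\mathbb K$ defined for all nets $\varphi:\mathfrak L\to\mathbb R$, such that (i) every element of $\mathbb K$ is a $\Lambda$-limit; (ii) if $\varphi(\lambda)=r\in\mathbb R$ for all $\lambda\supseteq\lambda_0$, then $\lim_{\lambda\uparrow\Lambda}\varphi(\lambda)=r$; (iii) $\Lambda$-limits commute with sums and products. The limit of a net $(\psi(\lambda))$ in $\mathbb R^N$ is taken coordinatewise, $\Omega^*\subseteq\mathbb K^N$ is the set of $\Lambda$-limits of nets in $\Omega$, and the $\Lambda$-limit of a net of functions $u_\lambda:\Omega\to\mathbb R$ is the function $\Omega^*\to\mathbb K$, $\lim_{\lambda\uparrow\Lambda}\psi(\lambda)\mapsto\lim_{\lambda\uparrow\Lambda}u_\lambda(\psi(\lambda))$. Let $\Omega\subseteq\mathbb R^N$ be an open set or the closure of an open set, and let $V(\Omega)$ be a vector space of real functions with $\mathcal D(\Omega)\subseteq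 V(\Omega)\subseteq\mathcal C^0(\overline\Omega)\cap L^1(\Omega)\cap L^2(\Omega)$. Let $\{e_a\}_{a\in\Omega}$ be a Hamel basis of $V(\Omega)$ and, for $\lambda\in\mathfrak L$, let $V_\lambda(\Omega)=\mathrm{Span}\{e_a : a\in\lambda\cap\Omega\}$. The space of ultrafunctions is $$V_\Lambda(\Omega)=\Big\{\lim_{\lambda\uparrow\Lambda}u_\lambda \;:\; u_\lambda\in V_\lambda(\Omega)\text{ for all }\lambda\in\mathfrak L\Big\}.$$ Let $V'(\Omega)$ be the space of linear functionals on $V(\Omega)$; a function $f$ such that $fv$ is integrable for all $v\in V(\Omega)$ is identified with the functional $v\mapsto\int_\Omega fv\,dx$. For $A:V(\Omega)\to V'(\Omega)$ and $u\in V_\Lambda(\Omega)$, let $\widetilde A(u)$ be the unique element of $V_\Lambda(\Omega)$ such that $$\int^*\widetilde A(u)\,\varphi\,dx=\langle A^*(u),\varphi\rangle\qquad\text{for all }\varphi\in V_\Lambda(\Omega),$$ where $\int^*\lim_{\lambda\uparrow\Lambda}w_\lambda\,dx=\lim_{\lambda\uparrow\Lambda}\int_\Omega w_\lambda\,dx$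 for integrable $w_\lambda$, and $\langle A^*(\lim_{\lambda\uparrow\Lambda}u_\lambda),\lim_{\lambda\uparrow\Lambda}\varphi_\lambda\rangle=\lim_{\lambda\uparrow\Lambda}\langle A(u_\lambda),\varphi_\lambda\rangle$ for $u_\lambda,\varphi_\lambda\in V(\Omega)$. \textbf{Theorem.} Let $W\subseteq V'(\Omega)$, let $\|\cdot\|_\sharp$ be any norm on $V(\Omega)$, and let $A:V(\Omega)\to W$ be continuous on the finite dimensional spaces $V_\lambda(\Omega)$, in the sense that for all $\lambda\in\mathfrak L$ and $v\in V_\lambda(\Omega)$ the function $u\mapsto\langle A(u),v\rangle$ is continuous on $V_\lambda(\Omega)$. Assume that for every $\lambda\in\mathfrak L$ there is $R_\lambda>0$ such that $$u\in V_\lambda(\Omega),\ \|u\|_\sharp=R_\lambda\ \Longrightarrow\ \langle A(u),u\rangle>0 .$$ Then the equation $\widetilde A(u)=0$ has at least one solution $u_\Lambda\in V_\Lambda(\Omega)$. -/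

import Mathlib

open MeasureTheory

namespace Ultra

noncomputable section

/-- The space `ℝ^N`. -/
abbrev Pt (N : ℕ) : Type := EuclideanSpace ℝ (Fin N)

/-- The parameter space: the finite subsets of `ℝ^N`, directed by inclusion. -/
abbrev Param (N : ℕ) : Type := Finset (Pt N)

/-- A `Λ`-limit with values in the ordered field `K`: the axioms of existence (with `K` a superreal
field, i.e. an ordered field properly extending `ℝ`, all of whose elements are `Λ`-limits of real
nets), of real numbers, and of sum and product. -/
structure LambdaLimit (N : ℕ) (K : Type*) [Field K] [LinearOrder K] [IsStrictOrderedRing K] where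
  /-- the inclusion of `ℝ` in `K` -/
  real : ℝ →+*o K
  real_not_surjective : ¬ Function.Surjective real
  /-- the `Λ`-limit of a real net -/
  lim : (Param N → ℝ) → K
  lim_surjective : Function.Surjective lim
  lim_eventually_const : ∀ (φ : Param N → ℝ) (r : ℝ) (l₀ : Param N),
    (∀ l, l₀ ⊆ l → φ l = r) → lim φ = real r
  lim_add : ∀ φ ψ : Param N → ℝ, lim φ + lim ψ = lim (fun l => φ l + ψ l)
  lim_mul : ∀ φ ψ : Param N → ℝ, lim φ * lim ψ = lim (fun l => φ l * ψ l)

/-- The axioms have a model as soon as `N ≥ 1`: the ultrapower of `ℝ` modulo any ultrafilter on the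
parameter space that contains all the sets `{l | l₀ ⊆ l}`. -/
theorem nonempty_lambdaLimit {N : ℕ} (hN : 1 ≤ N) (U : Ultrafilter (Param N))
    (hU : (U : Filter (Param N)) ≤ Filter.atTop) :
    Nonempty (LambdaLimit N ((U : Filter (Param N)).Germ ℝ)) := by
  classical
  have : Nonempty (Fin N) := ⟨⟨0, hN⟩⟩
  refine ⟨{
    real := ⟨⟨⟨⟨fun r => ((r : ℝ) : (U : Filter (Param N)).Germ ℝ), rfl⟩, fun _ _ => rfl⟩, rfl,
      fun _ _ => rfl⟩, fun a b h => Filter.Germ.const_le h⟩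
    real_not_surjective := ?_
    lim := fun φ => (φ : (U : Filter (Param N)).Germ ℝ)
    lim_surjective := fun ξ => Quotient.inductionOn' ξ (fun φ => ⟨φ, rfl⟩)
    lim_eventually_const := ?_
    lim_add := fun _ _ => rfl
    lim_mul := fun _ _ => rfl }⟩
  · intro h
    obtain ⟨r, hr⟩ := h ((fun l : Param N => (l.card : ℝ)) : Param N → ℝ)
    have h1 : ∀ᶠ l in (U : Filter (Param N)), r = (l.card : ℝ) := Filter.Germ.coe_eq.1 hr
    obtain ⟨n, hn⟩ := exists_nat_gt r
    obtain ⟨s, hs⟩ := Infinite.exists_subset_card_eq (Pt N) n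
    have h2 : ∀ᶠ l in (U : Filter (Param N)), s ≤ l := hU (Filter.eventually_ge_atTop s)
    obtain ⟨l, hl1, hl2⟩ := (h1.and h2).exists
    have h3 : n ≤ l.card := hs ▸ Finset.card_le_card hl2
    have h4 : (n : ℝ) ≤ l.card := by exact_mod_cast h3
    linarith
  · intro φ r l₀ h
    have h2 : ∀ᶠ l in (U : Filter (Param N)), l₀ ≤ l := hU (Filter.eventually_ge_atTop l₀)
    exact Filter.Germ.coe_eq.2 (h2.mono fun l hl => h l hl)

variable {N : ℕ} {K : Type*} [Field K] [LinearOrder K] [IsStrictOrderedRing K]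

/-- Lebesgue measure on a subset `Ω` of `ℝ^N`. -/
def leb (Ω : Set (Pt N)) : Measure Ω := Measure.comap Subtype.val volume

namespace LambdaLimit

variable (L : LambdaLimit N K)

theorem lim_const (r : ℝ) : L.lim (fun _ => r) = L.real r :=
  L.lim_eventually_const _ r ∅ fun _ _ => rfl

/-- The `Λ`-limit as a ring homomorphism. -/
def limHom : (Param N → ℝ) →+* K where
  toFun := L.lim
  map_one' := by
    have := L.lim_const 1
    rw [map_one] at this
    exact this
  map_zero' := by
    have := L.lim_const 0
    rw [map_zero] at this
    exact this
  map_add' φ ψ := (L.lim_add φ ψ).symm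
  map_mul' φ ψ := (L.lim_mul φ ψ).symm

theorem lim_congr {φ ψ d : Param N → ℝ} (hd : L.lim d = 0) (h : ∀ l, d l = 0 → φ l = ψ l) :
    L.lim φ = L.lim ψ := by
  have e : φ = ψ + ((φ - ψ) / d) * d := by
    funext l
    by_cases h0 : d l = 0
    · simp [h0, h l h0]
    · simp [h0]
  have h1 : L.limHom φ = L.limHom ψ + L.limHom ((φ - ψ) / d) * L.limHom d := by
    rw [← map_mul, ← map_add, ← e]
  have h2 : L.limHom d = 0 := hd
  rw [h2, mul_zero, add_zero] at h1
  exact h1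

/-- The `Λ`-limit of a net of vectors, a point of `K^N`. -/
def limVec (ψ : Param N → Pt N) : Fin N → K := fun i => L.lim fun l => ψ l i

/-- The `Λ`-limit of a family of subsets of `ℝ^N`. -/
def limSet (S : Param N → Set (Pt N)) : Set (Fin N → K) :=
  {ξ | ∃ ψ : Param N → Pt N, (∀ l, ψ l ∈ S l) ∧ L.limVec ψ = ξ}

/-- The natural extension `Ω^*` of a subset `Ω` of `ℝ^N`. -/
def star (Ω : Set (Pt N)) : Set (Fin N → K) := L.limSet fun _ => Ω

variable {Ω : Set (Pt N)}

/-- A net in `Ω` whose `Λ`-limit is the given point of `Ω^*`. -/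
def net (ξ : L.star Ω) (l : Param N) : Ω := ⟨ξ.2.choose l, ξ.2.choose_spec.1 l⟩

theorem limVec_net (ξ : L.star Ω) : L.limVec (fun l => (L.net ξ l : Pt N)) = ξ :=
  ξ.2.choose_spec.2

/-- The point of `Ω^*` that is the `Λ`-limit of a net in `Ω`. -/
def pt (ψ : Param N → Ω) : L.star Ω := ⟨L.limVec fun l => ψ l, fun l => ψ l, fun l => (ψ l).2, rfl⟩

/-- The `Λ`-limit of a net of functions `Ω → ℝ`, an internal function `Ω^* → K`; by `limFun_pt`
it does not depend on the net that represents the point `ξ`. -/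
def limFun (f : Param N → Ω → ℝ) (ξ : L.star Ω) : K := L.lim fun l => f l (L.net ξ l)

theorem limFun_pt (f : Param N → Ω → ℝ) (ψ : Param N → Ω) :
    L.limFun f (L.pt ψ) = L.lim fun l => f l (ψ l) := by
  set ψ' := L.net (L.pt ψ) with hψ'
  have h : L.limVec (fun l => (ψ' l : Pt N)) = L.limVec (fun l => (ψ l : Pt N)) :=
    L.limVec_net (L.pt ψ)
  let c : Fin N → Param N → ℝ := fun i l => (ψ' l : Pt N) i - (ψ l : Pt N) i
  have hc : ∀ i, L.limHom (c i) = 0 := by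
    intro i
    have h1 : c i = (fun l => (ψ' l : Pt N) i) - (fun l => (ψ l : Pt N) i) := rfl
    rw [h1, map_sub, sub_eq_zero]
    exact congrFun h i
  refine L.lim_congr (d := ∑ i, c i ^ 2) ?_ ?_
  · change L.limHom (∑ i, c i ^ 2) = 0
    simp [map_sum, map_pow, hc]
  · intro l hl
    have h0 : ∀ i, c i l = 0 := by
      rw [Finset.sum_apply] at hl
      intro i
      have := (Finset.sum_eq_zero_iff_of_nonneg (fun j _ => sq_nonneg (c j l))).1 hl i
        (Finset.mem_univ i)
      exact pow_eq_zero_iff (two_ne_zero) |>.1 this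
    have h1 : ψ' l = ψ l := by
      apply Subtype.ext
      ext i
      exact sub_eq_zero.1 (h0 i)
    change f l (ψ' l) = f l (ψ l)
    rw [h1]

/-- The `Λ`-limit of a family of sets of functions `Ω → ℝ`, a set of internal functions. -/
def limFunSet (F : Param N → Set (Ω → ℝ)) : Set (L.star Ω → K) :=
  {u | ∃ w : Param N → Ω → ℝ, (∀ l, w l ∈ F l) ∧ L.limFun w = u}

/-- The natural extension `F^*` of a set `F` of functions `Ω → ℝ`. -/
def starFun (F : Set (Ω → ℝ)) : Set (L.star Ω → K) := L.limFunSet fun _ => F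

/-- A net in `F` whose `Λ`-limit is the given element of `F^*`. -/
def netFun {F : Set (Ω → ℝ)} (u : L.starFun F) (l : Param N) : F :=
  ⟨u.2.choose l, u.2.choose_spec.1 l⟩

theorem limFun_netFun {F : Set (Ω → ℝ)} (u : L.starFun F) :
    L.limFun (fun l => (L.netFun u l : Ω → ℝ)) = u :=
  u.2.choose_spec.2

theorem exists_separating {u v : Param N → Ω → ℝ} (h : L.limFun u = L.limFun v) :
    ∃ d : Param N → ℝ, L.lim d = 0 ∧ ∀ l, d l = 0 → u l = v l := by
  classical
  rcases isEmpty_or_nonempty Ω with hΩ | ⟨⟨x₀⟩⟩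
  · exact ⟨0, map_zero L.limHom, fun l _ => funext fun x => isEmptyElim x⟩
  · have hx : ∀ l, ∃ x : Ω, u l x - v l x = 0 → u l = v l := by
      intro l
      by_cases he : u l = v l
      · exact ⟨x₀, fun _ => he⟩
      · obtain ⟨x, hx⟩ := Function.ne_iff.1 he
        exact ⟨x, fun h => absurd (sub_eq_zero.1 h) hx⟩
    choose x hx using hx
    refine ⟨fun l => u l (x l) - v l (x l), ?_, hx⟩
    have h1 := congrFun h (L.pt x)
    rw [limFun_pt, limFun_pt] at h1
    change L.limHom ((fun l => u l (x l)) - (fun l => v l (x l))) = 0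
    rw [map_sub, sub_eq_zero]
    exact h1

/-- The `Λ`-limit of a net of functionals `F → ℝ`, a functional `F^* → K`; by
`limFunctional_eq` it does not depend on the net that represents `u`. -/
def limFunctional {F : Set (Ω → ℝ)} (T : Param N → F → ℝ) (u : L.starFun F) : K :=
  L.lim fun l => T l (L.netFun u l)

theorem limFunctional_eq {F : Set (Ω → ℝ)} (T : Param N → F → ℝ) (u : L.starFun F)
    (w : Param N → F) (h : L.limFun (fun l => (w l : Ω → ℝ)) = u) :
    L.limFunctional T u = L.lim fun l => T l (w l) := by
  obtain ⟨d, hd, hd'⟩ := L.exists_separating ((L.limFun_netFun u).trans h.symm)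
  refine L.lim_congr hd fun l hl => ?_
  rw [Subtype.ext (hd' l hl)]

/-- The natural extension `∫^*` of the Lebesgue integral `L¹(Ω) → ℝ`. -/
def starIntegral (w : L.starFun {w : Ω → ℝ | Integrable w (leb Ω)}) : K :=
  L.limFunctional (fun _ w => ∫ x, w.1 x ∂leb Ω) w

end LambdaLimit

/-- The sets `Ω ⊆ ℝ^N` that are considered: open sets and closures of open sets. -/
def IsDomain (Ω : Set (Pt N)) : Prop := IsOpen Ω ∨ ∃ O : Set (Pt N), IsOpen O ∧ Ω = closure O

/-- `𝒟(Ω) ⊆ V(Ω) ⊆ 𝒞⁰(closure Ω) ∩ L¹(Ω) ∩ L²(Ω)`. A continuous function on `closure Ω` is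
identified with its restriction to the dense subset `Ω`. -/
structure IsFunctionSpace (Ω : Set (Pt N)) (V : Submodule ℝ (Ω → ℝ)) : Prop where
  testFunction_mem : ∀ f : Pt N → ℝ, ContDiff ℝ ((⊤ : ℕ∞) : WithTop ℕ∞) f → HasCompactSupport f →
    tsupport f ⊆ Ω → (fun x : Ω => f x) ∈ V
  continuous_closure : ∀ u ∈ V, ∃ g : Pt N → ℝ, ContinuousOn g (closure Ω) ∧ ∀ x : Ω, u x = g x
  integrable : ∀ u ∈ V, Integrable u (leb Ω)
  memLp_two : ∀ u ∈ V, MemLp u 2 (leb Ω)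

variable {Ω : Set (Pt N)} {V : Submodule ℝ (Ω → ℝ)}

/-- The dual `V'(Ω)` of `V(Ω)`: all linear functionals on `V(Ω)`. -/
abbrev VDual (V : Submodule ℝ (Ω → ℝ)) : Type := Module.Dual ℝ V

/-- A function `f` such that `f v` is integrable for all `v` in `V(Ω)` is identified
with the element `v ↦ ∫ f v` of `V'(Ω)`. -/
def VDual.ofFunction (V : Submodule ℝ (Ω → ℝ)) (f : Ω → ℝ)
    (hf : ∀ v ∈ V, Integrable (f * v) (leb Ω)) : VDual V where
  toFun v := ∫ x, (f * v.1) x ∂leb Ω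
  map_add' v w := by
    rw [← integral_add (hf _ v.2) (hf _ w.2)]
    congr 1
    funext x
    simp [mul_add]
  map_smul' c v := by
    rw [RingHom.id_apply, smul_eq_mul, ← integral_const_mul]
    congr 1
    funext x
    simp [mul_left_comm]

/-- `V_λ(Ω)`, the span of those elements `e_a` of the Hamel basis with `a ∈ λ`. -/
def Vsub (e : Module.Basis Ω ℝ V) (l : Param N) : Submodule ℝ V :=
  Submodule.span ℝ (e '' {a : Ω | (a : Pt N) ∈ l})

instance (e : Module.Basis Ω ℝ V) (l : Param N) : FiniteDimensional ℝ (Vsub e l) := by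
  refine FiniteDimensional.span_of_finite ℝ (Set.Finite.image _ ?_)
  exact l.finite_toSet.preimage Subtype.val_injective.injOn

namespace LambdaLimit

variable (L : LambdaLimit N K)

/-- The space of ultrafunctions `V_Λ(Ω)`, the `Λ`-limit of the spaces `V_λ(Ω)`. -/
def ultra (e : Module.Basis Ω ℝ V) : Set (L.star Ω → K) :=
  L.limFunSet fun l => ((Vsub e l).map V.subtype : Set (Ω → ℝ))

theorem exists_net (e : Module.Basis Ω ℝ V) (u : L.ultra e) :
    ∃ w : Param N → V, (∀ l, w l ∈ Vsub e l) ∧ L.limFun (fun l => (w l : Ω → ℝ)) = u := by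
  obtain ⟨w, hw, hu⟩ := u.2
  choose w' hw' h using hw
  refine ⟨w', hw', ?_⟩
  rw [← hu]
  congr 1
  funext l
  exact h l

/-- The ultrafunction that is the `Λ`-limit of a net with terms in the spaces `V_λ(Ω)`. -/
def toUltra (e : Module.Basis Ω ℝ V) (w : Param N → V) (hw : ∀ l, w l ∈ Vsub e l) : L.ultra e :=
  ⟨L.limFun fun l => (w l : Ω → ℝ), fun l => (w l : Ω → ℝ), fun l => ⟨w l, hw l, rfl⟩, rfl⟩

/-- The inclusion of `V_Λ(Ω)` in `V(Ω)^*`. -/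
def incl (e : Module.Basis Ω ℝ V) (u : L.ultra e) : L.starFun (V : Set (Ω → ℝ)) :=
  ⟨u.1, by
    obtain ⟨w, -, h⟩ := L.exists_net e u
    exact ⟨fun l => (w l : Ω → ℝ), fun l => (w l).2, h⟩⟩

end LambdaLimit

theorem IsFunctionSpace.integrable_mul (hV : IsFunctionSpace Ω V) (u v : V) :
    Integrable (u.1 * v.1) (leb Ω) :=
  (hV.memLp_two u.1 u.2).integrable_mul (hV.memLp_two v.1 v.2)

/-- The `L²` scalar product on `V(Ω)`. -/
def IsFunctionSpace.form (hV : IsFunctionSpace Ω V) : V →ₗ[ℝ] VDual V :=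
  LinearMap.mk₂ ℝ (fun u v => ∫ x, (u.1 * v.1) x ∂leb Ω)
    (fun u u' v => by
      rw [← integral_add (hV.integrable_mul u v) (hV.integrable_mul u' v)]
      congr 1; funext x; simp [add_mul])
    (fun c u v => by
      rw [smul_eq_mul, ← integral_const_mul]
      congr 1; funext x; simp [mul_assoc])
    (fun u v v' => by
      rw [← integral_add (hV.integrable_mul u v) (hV.integrable_mul u v')]
      congr 1; funext x; simp [mul_add])
    (fun c u v => by
      rw [smul_eq_mul, ← integral_const_mul]
      congr 1; funext x; simp [mul_left_comm])

theorem IsDomain.eq_zero (hΩ : IsDomain Ω) {u : Ω → ℝ} (hu : Continuous u)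
    (hi : Integrable (u * u) (leb Ω)) (h : ∫ x, (u * u) x ∂leb Ω = 0) : u = 0 := by
  obtain ⟨O, hO, hOΩ, hΩO, hm⟩ :
      ∃ O : Set (Pt N), IsOpen O ∧ O ⊆ Ω ∧ Ω ⊆ closure O ∧ MeasurableSet Ω := by
    rcases hΩ with hO | ⟨O, hO, rfl⟩
    · exact ⟨Ω, hO, subset_rfl, subset_closure, hO.measurableSet⟩
    · exact ⟨O, hO, subset_closure, subset_rfl, isClosed_closure.measurableSet⟩
  have hae : u * u =ᵐ[leb Ω] 0 :=
    (integral_eq_zero_iff_of_nonneg (fun x => mul_self_nonneg (u x)) hi).1 h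
  have : (leb Ω).IsOpenPosMeasure := by
    refine ⟨fun U hU hne h0 => ?_⟩
    obtain ⟨G, hG, rfl⟩ := isOpen_induced_iff.1 hU
    obtain ⟨x, hx⟩ := hne
    have hne' : (G ∩ O).Nonempty := mem_closure_iff.1 (hΩO x.2) G hG hx
    have hpos := (hG.inter hO).measure_pos (volume : Measure (Pt N)) hne'
    rw [leb, (MeasurableEmbedding.subtype_coe hm).comap_apply,
      Subtype.image_preimage_coe] at h0
    have hle : (volume : Measure (Pt N)) (G ∩ O) ≤ volume (Ω ∩ G) :=
      measure_mono fun y hy => ⟨hOΩ hy.2, hy.1⟩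
    exact absurd (le_antisymm (hle.trans h0.le) bot_le) hpos.ne'
  have h0 : u * u = 0 := ((hu.mul hu).ae_eq_iff_eq (leb Ω) continuous_zero).1 hae
  funext x
  exact mul_self_eq_zero.1 (congrFun h0 x)

theorem IsFunctionSpace.form_self (hΩ : IsDomain Ω) (hV : IsFunctionSpace Ω V) (u : V)
    (h : hV.form u u = 0) : u = 0 := by
  refine Subtype.ext (hΩ.eq_zero ?_ (hV.integrable_mul u u) h)
  obtain ⟨g, hg, he⟩ := hV.continuous_closure u.1 u.2
  have h1 : (u : Ω → ℝ) = Ω.domRestrict g := funext he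
  rw [h1]
  exact continuousOn_iff_continuous_domRestrict.1 (hg.mono subset_closure)

theorem exists_riesz_aux {E : Type*} [AddCommGroup E] [Module ℝ E] (f : E →ₗ[ℝ] E →ₗ[ℝ] ℝ)
    (hf : ∀ u, f u u = 0 → u = 0) (S : Submodule ℝ E) [FiniteDimensional ℝ S] (T : E →ₗ[ℝ] ℝ) :
    ∃ w ∈ S, ∀ φ ∈ S, f w φ = T φ := by
  let B : S →ₗ[ℝ] Module.Dual ℝ S := LinearMap.domRestrict₁₂ f S S
  have hinj : Function.Injective B := by
    refine (injective_iff_map_eq_zero B).2 fun w hw => Subtype.ext (hf w.1 ?_)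
    exact LinearMap.congr_fun hw w
  have hsurj : Function.Surjective B :=
    (LinearMap.injective_iff_surjective_of_finrank_eq_finrank
      Subspace.dual_finrank_eq.symm).1 hinj
  obtain ⟨w, hw⟩ := hsurj (T ∘ₗ S.subtype)
  exact ⟨w.1, w.2, fun φ hφ => LinearMap.congr_fun hw ⟨φ, hφ⟩⟩

theorem IsFunctionSpace.exists_riesz (hΩ : IsDomain Ω) (hV : IsFunctionSpace Ω V)
    (e : Module.Basis Ω ℝ V) (l : Param N) (T : VDual V) :
    ∃ w ∈ Vsub e l, ∀ φ ∈ Vsub e l, hV.form w φ = T φ :=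
  exists_riesz_aux hV.form (hV.form_self hΩ) (Vsub e l) T

namespace LambdaLimit

variable (L : LambdaLimit N K)

/-- The scalar product `∫^* u v` of two ultrafunctions. -/
def inner (hV : IsFunctionSpace Ω V) (e : Module.Basis Ω ℝ V) (u v : L.ultra e) : K :=
  L.starIntegral ⟨u.1 * v.1, by
    obtain ⟨w, -, hw⟩ := L.exists_net e u
    obtain ⟨z, -, hz⟩ := L.exists_net e v
    refine ⟨fun l => (w l).1 * (z l).1, fun l => hV.integrable_mul (w l) (z l), ?_⟩
    rw [← hw, ← hz]
    funext ξ
    exact (L.lim_mul _ _).symm⟩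

theorem inner_eq (hV : IsFunctionSpace Ω V) (e : Module.Basis Ω ℝ V) (u v : L.ultra e)
    (w z : Param N → V) (hw : L.limFun (fun l => (w l : Ω → ℝ)) = u)
    (hz : L.limFun (fun l => (z l : Ω → ℝ)) = v) :
    L.inner hV e u v = L.lim fun l => hV.form (w l) (z l) := by
  refine L.limFunctional_eq (F := {w : Ω → ℝ | Integrable w (leb Ω)})
    (fun _ w => ∫ x, w.1 x ∂leb Ω) _
    (fun l => ⟨(w l).1 * (z l).1, hV.integrable_mul (w l) (z l)⟩) ?_
  change _ = u.1 * v.1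
  rw [← hw, ← hz]
  funext ξ
  exact (L.lim_mul _ _).symm

/-- The natural extension `A^*` of an operator `A : V(Ω) → V'(Ω)`: it maps `u = lim u_λ` to the
`Λ`-limit of the functionals `A(u_λ)`. -/
def starOp (A : V → VDual V) (u : L.starFun (V : Set (Ω → ℝ))) :
    L.starFun (V : Set (Ω → ℝ)) → K :=
  L.limFunctional fun l v => A (L.netFun u l) v

theorem starOp_eq (A : V → VDual V) (u v : L.starFun (V : Set (Ω → ℝ)))
    (w z : Param N → V) (hw : L.limFun (fun l => (w l : Ω → ℝ)) = u)
    (hz : L.limFun (fun l => (z l : Ω → ℝ)) = v) :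
    L.starOp A u v = L.lim fun l => A (w l) (z l) := by
  refine (L.limFunctional_eq _ v z hz).trans ?_
  obtain ⟨d, hd, hd'⟩ := L.exists_separating ((L.limFun_netFun u).trans hw.symm)
  refine L.lim_congr hd fun l hl => ?_
  have h1 : L.netFun u l = w l := Subtype.ext (hd' l hl)
  rw [h1]

theorem existsUnique_tilde (hΩ : IsDomain Ω) (hV : IsFunctionSpace Ω V)
    (e : Module.Basis Ω ℝ V) (A : V → VDual V) (u : L.ultra e) :
    ∃! w : L.ultra e, ∀ φ : L.ultra e,
      L.inner hV e w φ = L.starOp A (L.incl e u) (L.incl e φ) := by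
  obtain ⟨z, hz, hzu⟩ := L.exists_net e u
  choose w hw hwφ using fun l => hV.exists_riesz hΩ e l (A (z l))
  refine ⟨L.toUltra e w hw, ?_, ?_⟩
  · intro φ
    obtain ⟨p, hp, hpφ⟩ := L.exists_net e φ
    rw [L.inner_eq hV e _ φ w p rfl hpφ, L.starOp_eq A _ _ z p hzu hpφ]
    congr 1
    funext l
    exact hwφ l (p l) (hp l)
  · intro w' hw'
    obtain ⟨q, hq, hqw⟩ := L.exists_net e w'
    let φ : L.ultra e := L.toUltra e (fun l => q l - w l) fun l => sub_mem (hq l) (hw l)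
    have h1 := hw' φ
    rw [L.inner_eq hV e w' φ q _ hqw rfl, L.starOp_eq A _ _ z _ hzu rfl] at h1
    have h2 : (fun l => A (z l) (q l - w l)) = fun l => hV.form (w l) (q l - w l) :=
      funext fun l => (hwφ l _ (sub_mem (hq l) (hw l))).symm
    rw [h2] at h1
    have h3 : L.lim (fun l => hV.form (q l - w l) (q l - w l)) = 0 := by
      have e1 : (fun l => hV.form (q l - w l) (q l - w l)) =
          (fun l => hV.form (q l) (q l - w l)) - fun l => hV.form (w l) (q l - w l) := by
        funext l
        rw [map_sub (hV.form) (q l) (w l)]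
        rfl
      rw [e1]
      change L.limHom _ = 0
      rw [map_sub, sub_eq_zero]
      exact h1
    refine Subtype.ext ?_
    rw [← hqw]
    funext ξ
    refine L.lim_congr h3 fun l hl => ?_
    exact congrFun (congrArg Subtype.val (sub_eq_zero.1 (hV.form_self hΩ _ hl))) _

/-- The extension of the operator `A : V(Ω) → V'(Ω)` to ultrafunctions: for `u` in `V_Λ(Ω)`, the
value at `u` is the only ultrafunction `w` such that `∫^* w φ = ⟨A^*(u), φ⟩` for all `φ` in
`V_Λ(Ω)`. -/
def tilde (hΩ : IsDomain Ω) (hV : IsFunctionSpace Ω V) (e : Module.Basis Ω ℝ V)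
    (A : V → VDual V) (u : L.ultra e) : L.ultra e :=
  (L.existsUnique_tilde hΩ hV e A u).choose

theorem tilde_spec (hΩ : IsDomain Ω) (hV : IsFunctionSpace Ω V) (e : Module.Basis Ω ℝ V)
    (A : V → VDual V) (u φ : L.ultra e) :
    L.inner hV e (L.tilde hΩ hV e A u) φ = L.starOp A (L.incl e u) (L.incl e φ) :=
  (L.existsUnique_tilde hΩ hV e A u).choose_spec.1 φ

end LambdaLimit

/-- `A` is continuous on the finite dimensional spaces `V_λ(Ω)`: for all `v` in `V_λ(Ω)`, the
function `u ↦ ⟨A(u), v⟩` is continuous on `V_λ(Ω)`. Continuity is expressed with the norm `p`; on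
a finite dimensional space all norms give the same notion. -/
def ContinuousOnSections (e : Module.Basis Ω ℝ V) (p : Seminorm ℝ V) (A : V → VDual V) : Prop :=
  ∀ l : Param N, ∀ v ∈ Vsub e l, ∀ u ∈ Vsub e l, ∀ ε > 0, ∃ δ > 0, ∀ u' ∈ Vsub e l,
    p (u' - u) < δ → |A u' v - A u v| < ε

end

end Ultra

/-!
An ultrafunction is a `Λ`-limit of functions `u_λ ∈ V_λ(Ω)`, and `Ã(u)` is determined by the net of
functionals `A(u_λ)` restricted to `V_λ(Ω)`. It therefore suffices to find, for every `λ`, some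
`u_λ ∈ V_λ(Ω)` such that `A(u_λ)` vanishes on `V_λ(Ω)` (`Ultra.exists_weak_solution`): then the
zero ultrafunction has the property that characterizes `Ã(lim u_λ)`.

In coordinates this is a statement about a continuous operator `F` from a Euclidean space to its
dual with `⟨F(u), u⟩ > 0` on a sphere of some norm (`exists_eq_zero_of_pos_on_sphere`). Composing
`F` with the radial retraction onto the ball of that norm gives a vector field that points outwards
far from the origin, and such a field has a zero (`exists_eq_zero_of_inner_pos`). This is a form of
Brouwer's theorem, which is deduced from the absence of smooth retractions of a ball onto its sphere
(`not_exists_contDiff_retraction`).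

For the latter the argument is that of Milnor and Rogers. Let `f` be a retraction and `h = f - id`.
For small `t ≥ 0` the map `id + t h` is an orientation preserving bijection of the ball, so that
`∫ det (1 + t h')` is the volume of the ball (`exists_setIntegral_det_eq`). The integral is
a polynomial in `t`, so it has the same value at `t = 1` (`exists_det_interpolation`). But there the
integrand `det f'` vanishes, because `‖f‖` is constant.
-/

/-! ### Bijectivity of small perturbations of the identity -/

section Brouwer

open Metric Set

variable {E : Type*} [NormedAddCommGroup E] [InnerProductSpace ℝ E]

/-- Extending by zero a function that vanishes on the sphere keeps its Lipschitz constant. -/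
theorem lipschitzWith_indicator_closedBall {r : ℝ} {h : E → E} {C : NNReal}
    (hC : LipschitzOnWith C h (closedBall 0 r)) (h0 : ∀ x, ‖x‖ = r → h x = 0) :
    LipschitzWith C ((closedBall (0 : E) r).indicator h) := by
  have key : ∀ x ∈ closedBall (0 : E) r, ∀ y ∉ closedBall (0 : E) r,
      dist (h x) 0 ≤ C * dist x y := by
    intro x hx y hy
    rw [mem_closedBall_zero_iff] at hx hy
    have hc : ContinuousOn (fun t : ℝ => ‖AffineMap.lineMap x y t‖) (Icc 0 1) := by
      fun_prop
    -- the segment from `x` to `y` meets the sphere, where `h` vanishes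
    obtain ⟨t, ht, hz⟩ := intermediate_value_Icc zero_le_one hc
      (show r ∈ Icc _ _ by simpa using ⟨hx, (not_le.1 hy).le⟩)
    set z : E := AffineMap.lineMap x y t with hzdef
    have hz' : ‖z‖ = r := hz
    calc dist (h x) 0 = dist (h x) (h z) := by rw [h0 z hz']
      _ ≤ C * dist x z := hC.dist_le_mul x (by simpa using hx) z (by simp [hz'])
      _ ≤ C * dist x y := by
        gcongr
        rw [hzdef, dist_left_lineMap, Real.norm_of_nonneg ht.1]
        exact mul_le_of_le_one_left dist_nonneg ht.2
  refine LipschitzWith.of_dist_le_mul fun x y => ?_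
  by_cases hx : x ∈ closedBall (0 : E) r <;> by_cases hy : y ∈ closedBall (0 : E) r
  · simpa [indicator_of_mem hx, indicator_of_mem hy] using hC.dist_le_mul x hx y hy
  · simpa [indicator_of_mem hx, indicator_of_notMem hy] using key x hx y hy
  · simpa [indicator_of_notMem hx, indicator_of_mem hy, dist_comm] using key y hy x hx
  · simp only [indicator_of_notMem hx, indicator_of_notMem hy, dist_self]
    positivity

variable [FiniteDimensional ℝ E]

/-- Surjectivity is the contraction principle: `x + k x = y` says that `x` is a fixed point of
`x ↦ y - k x`. -/
theorem bijective_id_add {k : E → E} {C : NNReal} (hk : LipschitzWith C k) (hC : C < 1) :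
    Function.Bijective fun x => x + k x := by
  refine ⟨fun x y hxy => ?_, fun y => ?_⟩
  · have h1 : x - y = k y - k x := by
      have : x + k x = y + k y := hxy
      rw [sub_eq_sub_iff_add_eq_add, this, add_comm]
    have h2 : dist x y ≤ C * dist x y := by
      calc dist x y = dist (k y) (k x) := by rw [dist_eq_norm, h1, dist_eq_norm]
        _ ≤ C * dist y x := hk.dist_le_mul y x
        _ = C * dist x y := by rw [dist_comm]
    have h3 : (C : ℝ) < 1 := hC
    exact dist_le_zero.1 (by nlinarith [dist_nonneg (x := x) (y := y)])
  · have hc : ContractingWith C fun x => y - k x :=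
      ⟨hC, LipschitzWith.of_dist_le_mul fun a b => by
        rw [dist_sub_left]; exact hk.dist_le_mul a b⟩
    refine ⟨hc.fixedPoint, ?_⟩
    have h1 : y - k hc.fixedPoint = hc.fixedPoint := hc.fixedPoint_isFixedPt
    change hc.fixedPoint + k hc.fixedPoint = y
    nth_rw 1 [← h1]
    exact sub_add_cancel _ _

/-- The map `x ↦ x + t h(x)`, extended by the identity outside the ball, is a bijection of the whole
space; as it fixes the complement of the ball, it permutes the ball. -/
theorem injOn_and_image_closedBall {r : ℝ} {h : E → E} {C : NNReal}
    (hC : LipschitzOnWith C h (closedBall 0 r)) (h0 : ∀ x, ‖x‖ = r → h x = 0)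
    {t : ℝ} (ht : ‖t‖₊ * C < 1) :
    InjOn (fun x => x + t • h x) (closedBall 0 r) ∧
      (fun x => x + t • h x) '' closedBall 0 r = closedBall 0 r := by
  set B := closedBall (0 : E) r
  set k : E → E := fun x => t • B.indicator h x with hk
  have hkl : LipschitzWith (‖t‖₊ * C) k :=
    (lipschitzWith_smul t).comp (lipschitzWith_indicator_closedBall hC h0)
  have hbij := bijective_id_add hkl ht
  have hin : EqOn (fun x => x + t • h x) (fun x => x + k x) B := fun x hx => by
    simp [hk, indicator_of_mem hx]
  have hout : ∀ x ∉ B, x + k x = x := fun x hx => by simp [hk, indicator_of_notMem hx]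
  refine ⟨(hbij.1.injOn).congr hin.symm, ?_⟩
  rw [hin.image_eq]
  refine Subset.antisymm ?_ fun y hy => ?_
  · rintro _ ⟨x, hx, rfl⟩
    by_contra hy
    have hfix : x + k x = x := hbij.1 (hout _ hy)
    exact hy (by simpa only [hfix] using hx)
  · obtain ⟨x, rfl⟩ := hbij.2 y
    refine ⟨x, ?_, rfl⟩
    by_contra hx
    exact hx (by simpa only [hout x hx] using hy)

/-! ### The determinant along a line -/

/-- The function `t ↦ det (1 + t M)` is a polynomial of degree at most `dim E`, so its value at `1`
is an affine combination, with coefficients that do not depend on `M`, of its values at `dim E + 1`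
nodes. -/
theorem exists_det_interpolation {t : Fin (Module.finrank ℝ E + 1) → ℝ}
    (ht : Function.Injective t) :
    ∃ c : Fin (Module.finrank ℝ E + 1) → ℝ, ∑ i, c i = 1 ∧
      ∀ M : E →L[ℝ] E, (1 + M).det = ∑ i, c i * (1 + t i • M).det := by
  refine ⟨fun i => (Lagrange.basis Finset.univ t i).eval 1, ?_, fun M => ?_⟩
  · rw [← Polynomial.eval_finsetSum, Lagrange.sum_basis ht.injOn Finset.univ_nonempty,
      Polynomial.eval_one]
  · let b := Module.finBasis ℝ E
    let m := LinearMap.toMatrix b b (M : E →ₗ[ℝ] E)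
    let P : Polynomial ℝ :=
      ((Polynomial.X : Polynomial ℝ) • m.map Polynomial.C + (1 : Matrix _ _ ℝ).map Polynomial.C).det
    have hP : ∀ s : ℝ, P.eval s = (1 + s • M).det := by
      intro s
      have h1 : (1 + s • M).det = (1 + s • m).det := by
        rw [ContinuousLinearMap.det, ← LinearMap.det_toMatrix b]
        congr 1
        simp [m, LinearMap.toMatrix_one]
      rw [h1, ← Polynomial.coe_evalRingHom, RingHom.map_det]
      congr 1
      ext i j
      simp only [RingHom.mapMatrix_apply, Matrix.map_apply, Matrix.add_apply, Matrix.smul_apply,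
        smul_eq_mul, Polynomial.coe_evalRingHom, Polynomial.eval_add, Polynomial.eval_mul,
        Polynomial.eval_X, Polynomial.eval_C]
      rw [add_comm]
    have hdeg : P.degree < (Finset.univ : Finset (Fin (Module.finrank ℝ E + 1))).card := by
      refine lt_of_le_of_lt Polynomial.degree_le_natDegree ?_
      have := Polynomial.natDegree_det_X_add_C_le m 1
      rw [Fintype.card_fin] at this
      rw [Finset.card_univ, Fintype.card_fin]
      exact_mod_cast Nat.lt_succ_of_le this
    have h2 := congrArg (Polynomial.eval 1) (Lagrange.eq_interpolate ht.injOn hdeg)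
    rw [hP, one_smul, Lagrange.interpolate_apply, Polynomial.eval_finsetSum] at h2
    rw [h2]
    refine Finset.sum_congr rfl fun i _ => ?_
    rw [Polynomial.eval_mul, Polynomial.eval_C, hP, mul_comm]

/-! ### Brouwer's theorem -/

section volume

variable [MeasurableSpace E] [BorelSpace E]

/-- For small `t` the map `x ↦ x + t h(x)` is an orientation preserving bijection of the ball, so
its Jacobian determinant integrates to the volume of the ball. -/
theorem exists_setIntegral_det_eq {r : ℝ} {h : E → E} (hh : ContDiff ℝ 1 h)
    (h0 : ∀ x, ‖x‖ = r → h x = 0) :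
    ∃ ε > 0, ∀ t : ℝ, 0 ≤ t → t < ε →
      ∫ x in closedBall (0 : E) r, (1 + t • fderiv ℝ h x).det =
        (volume : Measure E).real (closedBall 0 r) := by
  have hcpt : IsCompact (closedBall (0 : E) r) := isCompact_closedBall 0 r
  obtain ⟨C, hC⟩ := hh.contDiffOn.exists_lipschitzOnWith one_ne_zero
    (convex_closedBall (0 : E) r) hcpt
  have hpos : ∀ᶠ t in nhds (0 : ℝ), ∀ x ∈ closedBall (0 : E) r,
      0 < (1 + t • fderiv ℝ h x).det := by
    refine hcpt.eventually_forall_of_forall_eventually fun x _ => ?_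
    have hc : Continuous fun z : ℝ × E => (1 + z.1 • fderiv ℝ h z.2).det := by
      refine ContinuousLinearMap.continuous_det.comp (continuous_const.add ?_)
      exact continuous_fst.smul ((hh.continuous_fderiv one_ne_zero).comp continuous_snd)
    refine hc.continuousAt.eventually_const_lt ?_
    simp [ContinuousLinearMap.det]
  obtain ⟨ε, hε, hεp⟩ := Metric.eventually_nhds_iff.1 hpos
  refine ⟨min ε (1 / (C + 1)), by positivity, fun t ht htε => ?_⟩
  have htC : ‖t‖₊ * C < 1 := by
    have h1 : t * (C + 1) < 1 := (lt_div_iff₀ (by positivity)).1 (htε.trans_le (min_le_right _ _))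
    rw [← NNReal.coe_lt_coe]
    push_cast
    rw [Real.norm_of_nonneg ht]
    nlinarith
  obtain ⟨hinj, himg⟩ := injOn_and_image_closedBall hC h0 htC
  have hcv := integral_image_eq_integral_abs_det_fderiv_smul (volume : Measure E)
    (f' := fun x => 1 + t • fderiv ℝ h x)
    (measurableSet_closedBall : MeasurableSet (closedBall (0 : E) r))
    (fun x _ => ((hasFDerivAt_id x).add
      ((hh.differentiable one_ne_zero x).hasFDerivAt.const_smul t)).hasFDerivWithinAt)
    hinj (fun _ => (1 : ℝ))
  rw [show (id + t • h) '' closedBall 0 r = closedBall 0 r from himg] at hcv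
  rw [setIntegral_const, smul_eq_mul, mul_one] at hcv
  rw [hcv]
  refine setIntegral_congr_fun measurableSet_closedBall fun x hx => ?_
  have hd : dist t 0 < ε := by
    rw [dist_zero_right, Real.norm_of_nonneg ht]
    exact htε.trans_le (min_le_left _ _)
  simp only [smul_eq_mul, mul_one]
  exact (abs_of_pos (hεp hd x hx)).symm

/-- There is no continuously differentiable retraction of a ball onto its sphere. The retraction is
taken to be defined on the whole space, with values in the sphere. -/
theorem not_exists_contDiff_retraction {r : ℝ} (hr : 0 < r) {f : E → E} (hf : ContDiff ℝ 1 f)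
    (hnorm : ∀ x, ‖f x‖ = r) (hid : ∀ x, ‖x‖ = r → f x = x) : False := by
  set h : E → E := fun x => f x - x with hdef
  have hh : ContDiff ℝ 1 h := hf.sub contDiff_id
  obtain ⟨ε, hε, H⟩ := exists_setIntegral_det_eq hh (r := r) fun x hx => by
    simp [hdef, hid x hx]
  set d := Module.finrank ℝ E
  set t : Fin (d + 1) → ℝ := fun i => ε * ((i : ℝ) / (d + 1)) with htdef
  have ht : Function.Injective t := by
    intro i j hij
    have h1 : (d + 1 : ℝ) ≠ 0 := by positivity
    simp only [htdef, mul_eq_mul_left_iff, hε.ne', or_false, div_left_inj' h1] at hij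
    exact Fin.ext (by exact_mod_cast hij)
  have htε : ∀ i, 0 ≤ t i ∧ t i < ε := by
    intro i
    refine ⟨by positivity, mul_lt_of_lt_one_right hε ?_⟩
    rw [div_lt_one (by positivity)]
    exact_mod_cast i.2
  obtain ⟨c, hc1, hc⟩ := exists_det_interpolation ht
  have hint : ∀ i, IntegrableOn (fun x => c i * (1 + t i • fderiv ℝ h x).det)
      (closedBall (0 : E) r) := by
    intro i
    refine ContinuousOn.integrableOn_compact (isCompact_closedBall 0 r)
      (Continuous.continuousOn (continuous_const.mul
        (ContinuousLinearMap.continuous_det.comp (continuous_const.add ?_))))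
    exact (hh.continuous_fderiv one_ne_zero).const_smul (t i)
  have h1 : ∫ x in closedBall (0 : E) r, (1 + fderiv ℝ h x).det =
      (volume : Measure E).real (closedBall 0 r) := by
    rw [integral_congr_ae (Filter.Eventually.of_forall fun x => hc (fderiv ℝ h x)),
      integral_finsetSum _ fun i _ => hint i]
    simp_rw [integral_const_mul, fun i => H (t i) (htε i).1 (htε i).2]
    rw [← Finset.sum_mul, hc1, one_mul]
  -- the derivative of `f` at `x` takes its values in the hyperplane orthogonal to `f x`
  have h2 : ∀ x, (1 + fderiv ℝ h x).det = 0 := by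
    intro x
    have hfx : HasFDerivAt f (fderiv ℝ f x) x := (hf.differentiable one_ne_zero x).hasFDerivAt
    have e1 : 1 + fderiv ℝ h x = fderiv ℝ f x := by
      rw [show h = f - id from rfl, (hfx.sub (hasFDerivAt_id x)).fderiv]
      exact add_sub_cancel _ _
    rw [e1]
    by_contra hdet
    have hsurj : Function.Surjective (fderiv ℝ f x) :=
      (LinearMap.equivOfDetNeZero (fderiv ℝ f x : E →ₗ[ℝ] E) hdet).surjective
    obtain ⟨v, hv⟩ := hsurj (f x)
    have h3 := hfx.norm_sq
    have h4 : HasFDerivAt (fun y => ‖f y‖ ^ 2) (0 : E →L[ℝ] ℝ) x := by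
      simp_rw [hnorm]
      exact hasFDerivAt_const _ _
    have h5 := congrArg (fun T : E →L[ℝ] ℝ => T v) (h3.unique h4)
    simp [hv, hnorm, hr.ne'] at h5
  rw [integral_congr_ae (Filter.Eventually.of_forall h2), integral_zero] at h1
  have h6 : 0 < (volume : Measure E).real (closedBall 0 r) :=
    ENNReal.toReal_pos (measure_closedBall_pos _ _ hr).ne' measure_closedBall_lt_top.ne
  exact h6.ne h1

end volume

/-- A continuous self-map of `E` that is the identity far from the origin has a zero: otherwise a
smooth approximation of it, normalized, would retract a large ball onto its sphere. -/
theorem exists_eq_zero_of_eq_self {r : ℝ} (hr : 0 < r) {f : E → E} (hf : Continuous f)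
    (hid : ∀ x, r ≤ ‖x‖ → f x = x) : ∃ x, f x = 0 := by
  by_contra! hne
  borelize E
  have hS : IsClosed {x : E | 2 * r ≤ ‖x‖} := isClosed_le continuous_const continuous_norm
  have hU : IsOpen {x : E | r < ‖x‖} := isOpen_lt continuous_const continuous_norm
  -- a smooth `g` closer to `f` than `‖f‖` does not vanish
  obtain ⟨g, hg, hgf, hgS, -⟩ := hf.exists_contDiff_approx_and_eqOn (n := 1) hf.norm
    (fun x => norm_pos_iff.2 (hne x)) hS
    (hU.mem_nhdsSet.2 fun x (hx : 2 * r ≤ ‖x‖) => show r < ‖x‖ by linarith)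
    (contDiffOn_id.congr fun x (hx : r < ‖x‖) => hid x hx.le)
  have hg0 : ∀ x, g x ≠ 0 := fun x h => by simpa [h] using hgf x
  refine not_exists_contDiff_retraction (E := E) (r := 2 * r) (by positivity)
    (f := fun x => (2 * r * ‖g x‖⁻¹) • g x) ?_ (fun x => ?_) (fun x hx => ?_)
  · have hg' : ContDiff ℝ 1 g := hg
    exact (contDiff_const.mul ((hg'.norm ℝ hg0).inv fun x => norm_ne_zero_iff.2 (hg0 x))).smul hg'
  · have := norm_ne_zero_iff.2 (hg0 x)
    rw [norm_smul, Real.norm_of_nonneg (by positivity)]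
    field_simp
  · have h1 : g x = x := (hgS (show 2 * r ≤ ‖x‖ from hx.ge)).trans (hid x (by linarith))
    have h2 : 2 * r ≠ 0 := by positivity
    simp only [h1, hx, mul_inv_cancel₀ h2, one_smul]

/-- A continuous vector field that points outwards far from the origin has a zero: a convex
combination with the identity reduces the claim to maps that are the identity far away. -/
theorem exists_eq_zero_of_inner_pos {r : ℝ} (hr : 0 < r) {f : E → E} (hf : Continuous f)
    (hpos : ∀ x, r ≤ ‖x‖ → 0 < inner ℝ (f x) x) : ∃ x, f x = 0 := by
  -- the weight is `0` for `‖x‖ ≤ r` and `1` for `‖x‖ ≥ r + 1`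
  let c : E → ℝ := fun x => max 0 (min 1 (‖x‖ - r))
  have hc : Continuous c := by fun_prop
  obtain ⟨x, hx⟩ := exists_eq_zero_of_eq_self (r := r + 1) (by positivity)
    (f := fun x => (1 - c x) • f x + c x • x) (by fun_prop) fun x hx => by
      have : c x = 1 := by
        simp only [c]
        rw [min_eq_left (by linarith), max_eq_right zero_le_one]
      simp [this]
  rcases le_or_gt r ‖x‖ with h | h
  · exfalso
    have h1 : 0 ≤ c x := le_max_left _ _
    have h2 : c x ≤ 1 := max_le zero_le_one (min_le_left _ _)
    have h3 : (1 - c x) * inner ℝ (f x) x + c x * ‖x‖ ^ 2 = 0 := by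
      have := congrArg (fun y => inner ℝ y x) hx
      simpa [inner_add_left, inner_smul_left] using this
    have h4 := hpos x h
    have h5 : 0 < ‖x‖ ^ 2 := by have := hr.trans_le h; positivity
    rcases h1.eq_or_lt with h6 | h6
    · rw [← h6] at h3; linarith
    · nlinarith [mul_nonneg (sub_nonneg.2 h2) h4.le, mul_pos h6 h5]
  · have : c x = 0 := by
      simp only [c]
      exact max_eq_left ((min_le_right _ _).trans (by linarith))
    exact ⟨x, by simpa [this] using hx⟩

/-! ### Coercive operators -/

/-- An operator into the dual space that is positive on a sphere of some norm has a zero. -/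
theorem exists_eq_zero_of_pos_on_sphere {q : Seminorm ℝ E} (hq : ∀ x, q x = 0 → x = 0)
    {F : E → Module.Dual ℝ E} (hF : ∀ v, Continuous fun u => F u v) {R : ℝ} (hR : 0 < R)
    (hpos : ∀ u, q u = R → 0 < F u u) : ∃ u, F u = 0 := by
  have hqc : Continuous q :=
    continuousOn_univ.1 (q.convexOn.continuousOn isOpen_univ)
  -- the radial retraction onto the ball of radius `R` of `q` is `x ↦ s x • x`
  let s : E → ℝ := fun x => R / max (q x) R
  have hmax : ∀ x, 0 < max (q x) R := fun x => hR.trans_le (le_max_right _ _)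
  have hs : Continuous s := continuous_const.div (by fun_prop) fun x => (hmax x).ne'
  have hspos : ∀ x, 0 < s x := fun x => div_pos hR (hmax x)
  let b := stdOrthonormalBasis ℝ E
  let G : E → E := fun x => ∑ i, F (s x • x) (b i) • b i
  have hG : Continuous G := by
    refine continuous_finsetSum _ fun i _ => Continuous.smul ?_ continuous_const
    exact (hF (b i)).comp (hs.smul continuous_id)
  have hGi : ∀ x v, inner ℝ (G x) v = F (s x • x) v := by
    intro x v
    conv_rhs => rw [← b.sum_repr' v]
    simp only [G, sum_inner, inner_smul_left, map_sum, map_smul, smul_eq_mul]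
    exact Finset.sum_congr rfl fun i _ => by simp [mul_comm]
  obtain ⟨m, hm, hmq⟩ : ∃ m > 0, ∀ x, m * ‖x‖ ≤ q x := by
    rcases subsingleton_or_nontrivial E with hE | hE
    · exact ⟨1, one_pos, fun x => by simp [Subsingleton.elim x 0]⟩
    obtain ⟨x₀, hx₀, hmin⟩ := (isCompact_sphere (0 : E) 1).exists_isMinOn
      (NormedSpace.sphere_nonempty.2 zero_le_one) hqc.continuousOn
    refine ⟨q x₀, (apply_nonneg q x₀).lt_of_ne' fun h => ?_, fun x => ?_⟩
    · simp [hq x₀ h] at hx₀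
    · rcases eq_or_ne x 0 with rfl | hx
      · simp
      have hx' : 0 < ‖x‖ := norm_pos_iff.2 hx
      have h1 : q x₀ ≤ q (‖x‖⁻¹ • x) := hmin (by simp [norm_smul, hx'.ne'])
      rw [map_smul_eq_mul, norm_inv, norm_norm] at h1
      rwa [← le_div_iff₀ hx', div_eq_inv_mul]
  obtain ⟨x, hx⟩ := exists_eq_zero_of_inner_pos (r := R / m) (by positivity) hG fun x hx => by
    have h1 : R ≤ q x := by
      rw [div_le_iff₀ hm, mul_comm] at hx
      exact hx.trans (hmq x)
    have h2 : q (s x • x) = R := by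
      rw [map_smul_eq_mul, Real.norm_of_nonneg (hspos x).le]
      simp only [s, max_eq_left h1]
      exact div_mul_cancel₀ _ (hR.trans_le h1).ne'
    have h3 := hpos _ h2
    rw [map_smul, smul_eq_mul] at h3
    rw [hGi]
    exact pos_of_mul_pos_right h3 (hspos x).le
  refine ⟨s x • x, LinearMap.ext fun v => ?_⟩
  rw [← hGi, hx, inner_zero_left, LinearMap.zero_apply]

end Brouwer

/-! ### Ultrafunctions -/

/-- The equation `A(u) = 0` has a solution in each of the spaces `V_λ(Ω)`, in the weak sense that
`A(u)` vanishes on `V_λ(Ω)`. -/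
theorem Ultra.exists_weak_solution {N : ℕ} {Ω : Set (Ultra.Pt N)} {V : Submodule ℝ (Ω → ℝ)}
    (e : Module.Basis Ω ℝ V) {A : V → Ultra.VDual V} {p : Seminorm ℝ V}
    (hp : ∀ u : V, p u = 0 → u = 0) (hcont : Ultra.ContinuousOnSections e p A)
    (l : Ultra.Param N) {R : ℝ} (hR : 0 < R)
    (hA : ∀ u ∈ Ultra.Vsub e l, p u = R → 0 < A u u) :
    ∃ u ∈ Ultra.Vsub e l, ∀ v ∈ Ultra.Vsub e l, A u v = 0 := by
  let E := EuclideanSpace ℝ (Fin (Module.finrank ℝ (Ultra.Vsub e l)))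
  have : Module.Free ℝ (Ultra.Vsub e l) := Module.Free.of_divisionRing ℝ (Ultra.Vsub e l)
  let T : E ≃ₗ[ℝ] Ultra.Vsub e l := LinearEquiv.ofFinrankEq _ _ (by simp [E])
  let ι : E →ₗ[ℝ] V := (Ultra.Vsub e l).subtype ∘ₗ T.toLinearMap
  have hι : ∀ x, ι x ∈ Ultra.Vsub e l := fun x => (T x).2
  have hι0 : ∀ x, ι x = 0 → x = 0 := fun x hx =>
    T.map_eq_zero_iff.1 (Subtype.ext hx)
  let q : Seminorm ℝ E := p.comp ι
  have hqc : Continuous q := continuousOn_univ.1 (q.convexOn.continuousOn isOpen_univ)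
  have hF : ∀ v, Continuous fun x => (A (ι x) ∘ₗ ι) v := by
    intro v
    refine continuous_iff_continuousAt.2 fun x => Metric.tendsto_nhds.2 fun ε hε => ?_
    obtain ⟨δ, hδ, H⟩ := hcont l (ι v) (hι v) (ι x) (hι x) ε hε
    have h1 : Filter.Tendsto (fun y => q (y - x)) (nhds x) (nhds 0) := by
      have : Continuous fun y => q (y - x) := hqc.comp (continuous_id.sub continuous_const)
      simpa using this.tendsto x
    filter_upwards [h1.eventually_lt_const hδ] with y hy
    refine H (ι y) (hι y) ?_
    rw [← map_sub]
    exact hy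
  obtain ⟨x, hx⟩ := exists_eq_zero_of_pos_on_sphere (q := q) (fun x hx => hι0 x (hp _ hx)) hF hR
    fun x hx => hA (ι x) (hι x) hx
  refine ⟨ι x, hι x, fun v hv => ?_⟩
  have h2 : ι (T.symm ⟨v, hv⟩) = v := by simp [ι]
  rw [← h2]
  exact LinearMap.congr_fun hx _

theorem mainTheorem5 {N : ℕ} {K : Type*} [Field K] [LinearOrder K] [IsStrictOrderedRing K]
    (L : Ultra.LambdaLimit N K)
    (Ω : Set (Ultra.Pt N)) (hΩ : Ultra.IsDomain Ω)
    (V : Submodule ℝ (Ω → ℝ)) (hV : Ultra.IsFunctionSpace Ω V)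
    (e : Module.Basis Ω ℝ V)
    (W : Set (Ultra.VDual V)) (A : V → W)
    (p : Seminorm ℝ V) (hp : ∀ u : V, p u = 0 → u = 0)
    (hcont : Ultra.ContinuousOnSections e p (fun u => (A u : Ultra.VDual V)))
    (hA : ∀ l : Ultra.Param N, ∃ R : ℝ, 0 < R ∧
      ∀ u ∈ Ultra.Vsub e l, p u = R → 0 < (A u : Ultra.VDual V) u) :
    ∃ u : L.ultra e,
      ((L.tilde hΩ hV e (fun u => (A u : Ultra.VDual V)) u : L.ultra e) : L.star Ω → K) = 0 := by
  have hsol : ∀ l, ∃ u ∈ Ultra.Vsub e l, ∀ v ∈ Ultra.Vsub e l, (A u : Ultra.VDual V) v = 0 := by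
    intro l
    obtain ⟨R, hR, h⟩ := hA l
    exact Ultra.exists_weak_solution e hp hcont l hR h
  choose u hu huv using hsol
  have hlim0 : L.lim (fun _ => 0) = 0 := map_zero L.limHom
  let z : L.ultra e := L.toUltra e (fun _ => 0) fun l => zero_mem _
  have hz : (z : L.star Ω → K) = 0 := funext fun _ => hlim0
  refine ⟨L.toUltra e u hu, ?_⟩
  rw [← hz]
  refine congrArg Subtype.val ((L.existsUnique_tilde hΩ hV e _ (L.toUltra e u hu)).unique
    (L.tilde_spec hΩ hV e _ _) fun φ => ?_)
  obtain ⟨w, hw, hwφ⟩ := L.exists_net e φ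
  rw [L.inner_eq hV e z φ (fun _ => 0) w rfl hwφ, L.starOp_eq _ _ _ u w rfl hwφ]
  congr 1
  funext l
  rw [huv l (w l) (hw l), map_zero, LinearMap.zero_apply]
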